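/- **Theorem (uniqueness for constant mobility).** Let $d\in\{2,3\}$, let $\Omega\subset\mathbb R^d$ be a bounded Lipschitz domain and let $T>0$. Let $A:\mathbb R^d\to\mathbb R$ be continuously differentiable, positive on $\mathbb R^d\setminus\{0\}$ and positively two-homogeneous ($A(\lambda p)=\lambda^2A(p)$ for $\lambda>0$), with strongly monotone gradient: there is $a_0>0$ such that $(A'(p)-A'(q))\cdot(p-q)\ge a_0|p-q|^2$ for all $p,q\in\mathbb R^d$. Let the mobility $M$ be a positive constant, and let $\varphi_0\in H^1(\Omega)$. Consider the anisotropic Cahn–Hilliard system $$\partial_t\varphi=\nabla\cdot(M\nabla\mu),\qquad \mu=-\nabla\cdot A'(\nabla\varphi)+F'(\varphi)\qquad\text{in }\Omega_T=(0,T)\times\Omega,$$ with boundary conditions $A'(\nabla\varphi)\cdot\mathbf n=0=\nabla\mu\cdot\mathbf n$ on $(0,T)\times\partial\Omega$ and initial condition $\varphi(0)=\varphi_0$. Put $E(u)=\int_\Omega A(\nabla u)+F(u)\,dx$. Let $F$ be one of the following. * *Regular potential:* $F\in C^1(\mathbb R)$, and there are $p\in[2,6)$ and constants $B,C,C'\ge0$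 with $-B\le F(s)\le C(1+|s|^p)$ and $|F'(s)|\le C'(1+|s|^{p-1})$ for all $s\in\mathbb R$; moreover $F=F_1+F_2$ with $F_1,F_2\in C^2(\mathbb R)$, $F_1$ convex and $F_2'$ Lipschitz continuous. * *Logarithmic potential:* $F(s)=\frac\theta2\big[(1+s)\ln(1+s)+(1-s)\ln(1-s)\big]+\frac{\theta_c}2(1-s^2)$ on $(-1,1)$, extended continuously to $[-1,1]$, with $\theta>0$ and $\theta_c\in\mathbb R$. In this case assume in addition that $|\varphi_0|\le1$ a.e. in $\Omega$ and $\big|\frac1{|\Omega|}\int_\Omega\varphi_0\,dx\big|<1$. A pair $(\varphi,\mu)$ is called a weak solution if 1. $\varphi\in C([0,T];L^2(\Omega))\cap L^\infty(0,T;H^1(\Omega))\cap H^1(0,T;H^1(\Omega)')$, $\mu\in L^2(0,T;H^1(\Omega))$ and $F'(\varphi)\in L^2(0,T;L^2(\Omega))$; for the logarithmic potential also $|\varphi|<1$ a.e. in $\Omega_T$; 2. for almost every $t\in[0,T]$ and all $\zeta,\eta\in H^1(\Omega)$, $$\langle\partial_t\varphi,\zeta\rangle_{H^1(\Omega)}=-\int_\Omega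 M\,\nabla\mu\cdot\nabla\zeta\,dx,\qquad \int_\Omega\mu\,\eta\,dx=\int_\Omega A'(\nabla\varphi)\cdot\nabla\eta+F'(\varphi)\,\eta\,dx,$$ and $\varphi(0)=\varphi_0$ a.e. in $\Omega$; 3. $E(\varphi(t))+\frac12\int_0^t\int_\Omega M|\nabla\mu|^2\,dx\,ds\le E(\varphi_0)$ for almost every $t\in[0,T]$ if $F$ is regular, and for every $t\in[0,T]$ if $F$ is the logarithmic potential. Then the weak solution is unique: if $(\varphi,\mu)$ and $(\varphi_*,\mu_*)$ are weak solutions with the same initial datum $\varphi_0$, then $\varphi(t)=\varphi_*(t)$ in $L^2(\Omega)$ for all $t\in[0,T]$, and $\mu(t)=\mu_*(t)$ in $H^1(\Omega)$ for almost every $t\in[0,T]$. -/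

import Mathlib

open MeasureTheory Set

noncomputable section

namespace AnisoCH

/-- The space `ℝ^d` with its Euclidean norm. -/
abbrev Euc (d : ℕ) : Type := EuclideanSpace ℝ (Fin d)

/-! ### Bounded Lipschitz domains -/

/-- Near each boundary point, for a suitable unit vector `e` (the vertical direction) and a
Lipschitz function `g` on the hyperplane orthogonal to `e`, the set `Ω` is the part of a
neighbourhood `U` lying strictly above the graph of `g`. -/
def HasLipschitzBoundary {d : ℕ} (Ω : Set (Euc d)) : Prop :=
  ∀ x₀ ∈ frontier Ω, ∃ (e : Euc d) (g : (Submodule.span ℝ {e})ᗮ → ℝ) (K : NNReal)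
    (U : Set (Euc d)), ‖e‖ = 1 ∧ LipschitzWith K g ∧ IsOpen U ∧ x₀ ∈ U ∧
      ∀ x ∈ U, x ∈ Ω ↔
        g ((Submodule.span ℝ {e})ᗮ.orthogonalProjectionOnto x) < inner ℝ e x

/-- A bounded domain (nonempty, open, connected) with Lipschitz boundary. -/
structure IsBoundedLipschitzDomain {d : ℕ} (Ω : Set (Euc d)) : Prop where
  isOpen : IsOpen Ω
  isConnected : IsConnected Ω
  isBounded : Bornology.IsBounded Ω
  lipschitz : HasLipschitzBoundary Ω

/-! ### The spaces `L²(Ω)` and `H¹(Ω)` -/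

/-- `L²(Ω)`. -/
abbrev L2 {d : ℕ} (Ω : Set (Euc d)) : Type := Lp ℝ 2 (volume.restrict Ω)

/-- `L²(Ω; ℝ^d)`. -/
abbrev L2vec {d : ℕ} (Ω : Set (Euc d)) : Type := Lp (Euc d) 2 (volume.restrict Ω)

/-- `G` is the weak gradient of `u` on `Ω`: integration by parts in every direction `v`, against
every smooth function with compact support in `Ω`. -/
def IsWeakGradient {d : ℕ} (Ω : Set (Euc d)) (u : L2 Ω) (G : L2vec Ω) : Prop :=
  ∀ η : Euc d → ℝ, ContDiff ℝ (⊤ : ℕ∞) η → HasCompactSupport η → tsupport η ⊆ Ω →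
    ∀ v : Euc d,
      ∫ x in Ω, u x * fderiv ℝ η x v = - ∫ x in Ω, inner ℝ (G x) v * η x

theorem integrable_mul_test {d : ℕ} {Ω : Set (Euc d)} (u : L2 Ω) {h : Euc d → ℝ}
    (hc : Continuous h) (hs : HasCompactSupport h) :
    Integrable (fun x => u x * h x) (volume.restrict Ω) :=
  ((Lp.memLp u).locallyIntegrable (by norm_num)).integrable_smul_right_of_hasCompactSupport hc hs

theorem integrable_inner_mul_test {d : ℕ} {Ω : Set (Euc d)} (G : L2vec Ω) (v : Euc d)
    {h : Euc d → ℝ} (hc : Continuous h) (hs : HasCompactSupport h) :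
    Integrable (fun x => inner ℝ (G x) v * h x) (volume.restrict Ω) :=
  (((Lp.memLp G).inner_const (𝕜 := ℝ) v).locallyIntegrable
    (by norm_num)).integrable_smul_right_of_hasCompactSupport hc hs

theorem IsWeakGradient.add {d : ℕ} {Ω : Set (Euc d)} {u u' : L2 Ω} {G G' : L2vec Ω}
    (h : IsWeakGradient Ω u G) (h' : IsWeakGradient Ω u' G') :
    IsWeakGradient Ω (u + u') (G + G') := by
  intro η hη hs ht v
  have hd : Continuous fun x => fderiv ℝ η x v :=
    (hη.continuous_fderiv (by simp)).clm_apply continuous_const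
  have hds : HasCompactSupport fun x => fderiv ℝ η x v := hs.fderiv_apply ℝ v
  have e1 : ∫ x in Ω, (u + u' : L2 Ω) x * fderiv ℝ η x v
      = ∫ x in Ω, (u x * fderiv ℝ η x v + u' x * fderiv ℝ η x v) := by
    refine integral_congr_ae ?_
    filter_upwards [Lp.coeFn_add u u'] with x hx
    rw [hx, Pi.add_apply, add_mul]
  have e2 : ∫ x in Ω, inner ℝ ((G + G' : L2vec Ω) x) v * η x
      = ∫ x in Ω, (inner ℝ (G x) v * η x + inner ℝ (G' x) v * η x) := by
    refine integral_congr_ae ?_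
    filter_upwards [Lp.coeFn_add G G'] with x hx
    rw [hx, Pi.add_apply, inner_add_left, add_mul]
  rw [e1, e2, integral_add (integrable_mul_test u hd hds) (integrable_mul_test u' hd hds),
    integral_add (integrable_inner_mul_test G v hη.continuous hs)
      (integrable_inner_mul_test G' v hη.continuous hs), h η hη hs ht v, h' η hη hs ht v]
  ring

theorem IsWeakGradient.smul {d : ℕ} {Ω : Set (Euc d)} (c : ℝ) {u : L2 Ω} {G : L2vec Ω}
    (h : IsWeakGradient Ω u G) : IsWeakGradient Ω (c • u) (c • G) := by
  intro η hη hs ht v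
  have e1 : ∫ x in Ω, (c • u : L2 Ω) x * fderiv ℝ η x v
      = ∫ x in Ω, c * (u x * fderiv ℝ η x v) := by
    refine integral_congr_ae ?_
    filter_upwards [Lp.coeFn_smul c u] with x hx
    rw [hx, Pi.smul_apply, smul_eq_mul, mul_assoc]
  have e2 : ∫ x in Ω, inner ℝ ((c • G : L2vec Ω) x) v * η x
      = ∫ x in Ω, c * (inner ℝ (G x) v * η x) := by
    refine integral_congr_ae ?_
    filter_upwards [Lp.coeFn_smul c G] with x hx
    rw [hx, Pi.smul_apply, real_inner_smul_left, mul_assoc]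
  rw [e1, e2, integral_const_mul, integral_const_mul, h η hη hs ht v]
  ring

theorem IsWeakGradient.zero {d : ℕ} (Ω : Set (Euc d)) :
    IsWeakGradient Ω (0 : L2 Ω) (0 : L2vec Ω) := by
  intro η hη hs ht v
  have e1 : ∫ x in Ω, (0 : L2 Ω) x * fderiv ℝ η x v = 0 := by
    refine integral_eq_zero_of_ae ?_
    filter_upwards [Lp.coeFn_zero ℝ 2 (volume.restrict Ω)] with x hx
    rw [hx]; simp
  have e2 : ∫ x in Ω, inner ℝ ((0 : L2vec Ω) x) v * η x = 0 := by
    refine integral_eq_zero_of_ae ?_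
    filter_upwards [Lp.coeFn_zero (Euc d) 2 (volume.restrict Ω)] with x hx
    rw [hx]; simp
  rw [e1, e2, neg_zero]

/-- The pairs `(u, ∇u)` in `L²(Ω) × L²(Ω; ℝ^d)`. The weak gradient of `u` on an open set is
unique. -/
def sobolevGraph {d : ℕ} (Ω : Set (Euc d)) : Submodule ℝ (WithLp 2 (L2 Ω × L2vec Ω)) where
  carrier := {w | IsWeakGradient Ω w.fst w.snd}
  add_mem' := fun h h' => h.add h'
  zero_mem' := IsWeakGradient.zero Ω
  smul_mem' := fun c _ h => h.smul c

/-- The Sobolev space `H¹(Ω) = W^{1,2}(Ω)`, with the inner product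
`(u, v) = ∫_Ω u v + ∫_Ω ∇u · ∇v`. -/
def H1 {d : ℕ} (Ω : Set (Euc d)) : Type := sobolevGraph Ω

instance {d : ℕ} (Ω : Set (Euc d)) : NormedAddCommGroup (H1 Ω) :=
  inferInstanceAs (NormedAddCommGroup (sobolevGraph Ω))

instance {d : ℕ} (Ω : Set (Euc d)) : InnerProductSpace ℝ (H1 Ω) :=
  inferInstanceAs (InnerProductSpace ℝ (sobolevGraph Ω))

/-- The embedding of `H¹(Ω)` in `L²(Ω)`. -/
def H1.toL2 {d : ℕ} (Ω : Set (Euc d)) : H1 Ω →L[ℝ] L2 Ω :=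
  (WithLp.fstL 2 ℝ (L2 Ω) (L2vec Ω)).comp (sobolevGraph Ω).subtypeL

/-- The weak gradient, from `H¹(Ω)` to `L²(Ω; ℝ^d)`. -/
def H1.grad {d : ℕ} (Ω : Set (Euc d)) : H1 Ω →L[ℝ] L2vec Ω :=
  (WithLp.sndL 2 ℝ (L2 Ω) (L2vec Ω)).comp (sobolevGraph Ω).subtypeL

/-- The dual space `H¹(Ω)'`. -/
abbrev H1Dual {d : ℕ} (Ω : Set (Euc d)) : Type := H1 Ω →L[ℝ] ℝ

/-- The embedding of `L²(Ω)` in `H¹(Ω)'`, where `f` acts as `ζ ↦ ∫_Ω f ζ`. -/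
def L2.toDual {d : ℕ} (Ω : Set (Euc d)) (f : L2 Ω) : H1Dual Ω :=
  (innerSL ℝ f).comp (H1.toL2 Ω)

/-! ### Assumptions on the data -/

/-- Assumptions on the anisotropy `A`. -/
structure IsAdmissibleAnisotropy {d : ℕ} (A : Euc d → ℝ) : Prop where
  contDiff : ContDiff ℝ 1 A
  pos : ∀ p, p ≠ 0 → 0 < A p
  homogeneous : ∀ (l : ℝ) (p : Euc d), 0 < l → A (l • p) = l ^ 2 * A p
  stronglyMonotone : ∃ a₀ : ℝ, 0 < a₀ ∧ ∀ p q : Euc d,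
    a₀ * ‖p - q‖ ^ 2 ≤ inner ℝ (gradient A p - gradient A q) (p - q)

/-- Assumptions on the (gradient- and phase-dependent) mobility `M`. -/
structure IsAdmissibleMobility {d : ℕ} (M : Euc d → ℝ → ℝ) : Prop where
  continuous : Continuous fun z : Euc d × ℝ => M z.1 z.2
  bounds : ∃ M₀ M₁ : ℝ, 0 < M₀ ∧ M₀ ≤ M₁ ∧ ∀ p s, M₀ ≤ M p s ∧ M p s ≤ M₁

/-- Regular potential: continuously differentiable with growth of order `p ∈ [2, 6)`. -/
def IsRegularPotential (F : ℝ → ℝ) : Prop :=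
  ContDiff ℝ 1 F ∧
  ∃ p : ℝ, 2 ≤ p ∧ p < 6 ∧ ∃ B C C' : ℝ, 0 ≤ B ∧ 0 ≤ C ∧ 0 ≤ C' ∧
    ∀ s : ℝ, -B ≤ F s ∧ F s ≤ C * (1 + |s| ^ p) ∧ |deriv F s| ≤ C' * (1 + |s| ^ (p - 1))

/-- `F` is the sum of a convex `C²` function and a `C²` function with Lipschitz derivative. -/
def HasConvexSplitting (F : ℝ → ℝ) : Prop :=
  ∃ F₁ F₂ : ℝ → ℝ, ContDiff ℝ 2 F₁ ∧ ContDiff ℝ 2 F₂ ∧ (∀ s, F s = F₁ s + F₂ s) ∧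
    ConvexOn ℝ univ F₁ ∧ ∃ L : NNReal, LipschitzWith L (deriv F₂)

/-- The logarithmic potential. Only its values on `[-1, 1]` (at `±1` these are the limits, because
of `Real.log 0 = 0`) and its derivative on `(-1, 1)` are relevant. -/
def logPotential (θ θc : ℝ) (s : ℝ) : ℝ :=
  θ / 2 * ((1 + s) * Real.log (1 + s) + (1 - s) * Real.log (1 - s)) + θc / 2 * (1 - s ^ 2)

/-- The energy `E(u) = ∫_Ω A(∇u) + F(u)`. -/
def energy {d : ℕ} (Ω : Set (Euc d)) (A : Euc d → ℝ) (F : ℝ → ℝ) (u : H1 Ω) : ℝ :=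
  ∫ x in Ω, (A (H1.grad Ω u x) + F (H1.toL2 Ω u x))

/-! ### Weak solutions -/

/-- `dφ ∈ L²(0,T;H¹(Ω)')` is the weak time derivative of `φ`, as a function with values in
`H¹(Ω)'`. -/
def IsTimeDerivative {d : ℕ} (Ω : Set (Euc d)) (T : ℝ) (φ : ℝ → L2 Ω) (dφ : ℝ → H1Dual Ω) :
    Prop :=
  MemLp dφ 2 (volume.restrict (Ioo 0 T)) ∧
  ∀ χ : ℝ → ℝ, ContDiff ℝ (⊤ : ℕ∞) χ → HasCompactSupport χ → tsupport χ ⊆ Ioo 0 T →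
    ∫ t in Ioo 0 T, deriv χ t • L2.toDual Ω (φ t) = - ∫ t in Ioo 0 T, χ t • dφ t

/-- The regularity requirements, the weak formulation and the initial condition. Here `Φ` is `φ`
regarded as a function with values in `H¹(Ω)`, so that `∇φ(t)` is `H1.grad Ω (Φ t)`. -/
structure SolvesWeakly {d : ℕ} (Ω : Set (Euc d)) (T : ℝ) (A : Euc d → ℝ) (M : Euc d → ℝ → ℝ)
    (F : ℝ → ℝ) (φ₀ : H1 Ω) (φ : ℝ → L2 Ω) (Φ : ℝ → H1 Ω) (μ : ℝ → H1 Ω) : Prop where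
  /-- `φ ∈ C([0,T];L²(Ω))` -/
  continuousOn : ContinuousOn φ (Icc 0 T)
  /-- `φ ∈ L^∞(0,T;H¹(Ω))` -/
  eq_ae : ∀ᵐ t ∂(volume.restrict (Ioo 0 T)), H1.toL2 Ω (Φ t) = φ t
  memLp_top : MemLp Φ ⊤ (volume.restrict (Ioo 0 T))
  /-- `μ ∈ L²(0,T;H¹(Ω))` -/
  memLp_potential : MemLp μ 2 (volume.restrict (Ioo 0 T))
  /-- `F'(φ) ∈ L²(0,T;L²(Ω))` -/
  memLp_deriv : ∃ w : ℝ → L2 Ω, MemLp w 2 (volume.restrict (Ioo 0 T)) ∧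
    ∀ᵐ t ∂(volume.restrict (Ioo 0 T)), ∀ᵐ x ∂(volume.restrict Ω), w t x = deriv F (φ t x)
  /-- `φ ∈ H¹(0,T;H¹(Ω)')`, and the first equation holds -/
  evolution : ∃ dφ : ℝ → H1Dual Ω, IsTimeDerivative Ω T φ dφ ∧
    ∀ᵐ t ∂(volume.restrict (Ioo 0 T)), ∀ ζ : H1 Ω,
      dφ t ζ = - ∫ x in Ω, M (H1.grad Ω (Φ t) x) (φ t x) *
        inner ℝ (H1.grad Ω (μ t) x) (H1.grad Ω ζ x)
  /-- the second equation holds -/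
  potential : ∀ᵐ t ∂(volume.restrict (Ioo 0 T)), ∀ η : H1 Ω,
    ∫ x in Ω, H1.toL2 Ω (μ t) x * H1.toL2 Ω η x =
      ∫ x in Ω, (inner ℝ (gradient A (H1.grad Ω (Φ t) x)) (H1.grad Ω η x)
        + deriv F (φ t x) * H1.toL2 Ω η x)
  initial : φ 0 = H1.toL2 Ω φ₀

/-- The dissipated energy `½ ∫_0^t ∫_Ω M(∇φ,φ) |∇μ|²`. -/
def dissipation {d : ℕ} (Ω : Set (Euc d)) (M : Euc d → ℝ → ℝ) (φ : ℝ → L2 Ω) (Φ : ℝ → H1 Ω)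
    (μ : ℝ → H1 Ω) (t : ℝ) : ℝ :=
  (1 / 2) * ∫ s in Ioo 0 t, ∫ x in Ω,
    M (H1.grad Ω (Φ s) x) (φ s x) * ‖H1.grad Ω (μ s) x‖ ^ 2

/-- Weak solutions for a regular potential `F`. -/
def IsWeakSolution {d : ℕ} (Ω : Set (Euc d)) (T : ℝ) (A : Euc d → ℝ) (M : Euc d → ℝ → ℝ)
    (F : ℝ → ℝ) (φ₀ : H1 Ω) (φ : ℝ → L2 Ω) (μ : ℝ → H1 Ω) : Prop :=
  ∃ Φ : ℝ → H1 Ω, SolvesWeakly Ω T A M F φ₀ φ Φ μ ∧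
    ∀ᵐ t ∂(volume.restrict (Ioo 0 T)),
      energy Ω A F (Φ t) + dissipation Ω M φ Φ μ t ≤ energy Ω A F φ₀

/-- Weak solutions for the logarithmic potential: in addition `|φ| < 1` almost everywhere, and the
energy inequality holds at every time. -/
def IsLogWeakSolution {d : ℕ} (Ω : Set (Euc d)) (T : ℝ) (A : Euc d → ℝ) (M : Euc d → ℝ → ℝ)
    (θ θc : ℝ) (φ₀ : H1 Ω) (φ : ℝ → L2 Ω) (μ : ℝ → H1 Ω) : Prop :=
  ∃ Φ : ℝ → H1 Ω, SolvesWeakly Ω T A M (logPotential θ θc) φ₀ φ Φ μ ∧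
    (∀ᵐ t ∂(volume.restrict (Ioo 0 T)), ∀ᵐ x ∂(volume.restrict Ω), |φ t x| < 1) ∧
    ∀ t ∈ Icc 0 T, ∃ u : H1 Ω, H1.toL2 Ω u = φ t ∧
      energy Ω A (logPotential θ θc) u + dissipation Ω M φ Φ μ t
        ≤ energy Ω A (logPotential θ θc) φ₀

/-- Two pairs are the same element of `C([0,T];L²(Ω)) × L²(0,T;H¹(Ω))`. -/
def SamePair {d : ℕ} (Ω : Set (Euc d)) (T : ℝ) (φ φ' : ℝ → L2 Ω) (μ μ' : ℝ → H1 Ω) : Prop :=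
  (∀ t ∈ Icc 0 T, φ t = φ' t) ∧ ∀ᵐ t ∂(volume.restrict (Ioo 0 T)), μ t = μ' t

end AnisoCH

end

/-!
Two solutions `(φ, μ)` and `(φ', μ')` are compared through the primitive
`V(t) = ∫_0^t (∇μ - ∇μ') ds` in `L²(Ω; ℝ^d)`. For constant mobility `m` the first equation is
linear, and integrating it in time gives, with `u = φ - φ'`,
`∫_Ω u(t) ζ = -m ∫_Ω V(t) · ∇ζ` for all `t ∈ [0, T]` and `ζ ∈ H¹(Ω)`
(`SolvesWeakly.inner_eq`, which rests on the du Bois-Reymond lemma `eq_add_integral_of_weakDeriv`).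
So `-m V` plays the part usually played by the gradient of the inverse Neumann Laplacian of `u`.
Working with `V` directly replaces solving a Neumann problem and a Poincaré inequality.

Taking `ζ = μ - μ'` here, and `u` as a test function in the second equation, yields
`m (V, V') = -(u, μ - μ') ≤ -a₀ |∇u|² + L |u|²`
almost everywhere in time (`SolvesWeakly.potential_coercive`): the gradient of `A` is strongly
monotone, and `F'` is monotone up to a Lipschitz term. For the logarithmic potential the last point
uses `|φ| < 1`. Taking `ζ = u` gives `|u|² = -m (V, ∇u) ≤ m |V| |∇u|`, so completing the square
leaves `(V, V') ≤ C |V|²`. Since `V(0) = 0`, Grönwall's lemma in the absolutely continuous setting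
(`integral_eq_zero_of_inner_le`) gives `V = 0`. Hence `u = 0`, and the second equation determines
`μ` as an element of `L²(Ω)`, which determines it in `H¹(Ω)` (`H1.toL2_injective`).
-/

namespace AnisoCH

open Filter Topology

/-! ### Weak derivatives in time -/

theorem exists_Icc_of_isCompact_subset_Ioo {T : ℝ} (hT : 0 < T) {K : Set ℝ} (hK : IsCompact K)
    (hKT : K ⊆ Ioo 0 T) : ∃ a b, 0 < a ∧ b < T ∧ K ⊆ Icc a b := by
  have hc : IsCompact (insert (T / 2) K) := hK.insert _
  have hs : insert (T / 2) K ⊆ Ioo 0 T := insert_subset ⟨by linarith, by linarith⟩ hKT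
  obtain ⟨a, ha⟩ := hc.exists_isLeast (insert_nonempty _ _)
  obtain ⟨b, hb⟩ := hc.exists_isGreatest (insert_nonempty _ _)
  exact ⟨a, b, (hs ha.1).1, (hs hb.1).2, fun x hx =>
    ⟨ha.2 (mem_insert_of_mem _ hx), hb.2 (mem_insert_of_mem _ hx)⟩⟩

/-- A test function on `(0, T)` with vanishing integral is the derivative of a test function. -/
theorem exists_test_primitive {T : ℝ} (hT : 0 < T) {ψ : ℝ → ℝ} (hψ : ContDiff ℝ (⊤ : ℕ∞) ψ)
    (hs : HasCompactSupport ψ) (ht : tsupport ψ ⊆ Ioo 0 T) (h0 : ∫ t, ψ t = 0) :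
    ∃ χ : ℝ → ℝ, ContDiff ℝ (⊤ : ℕ∞) χ ∧ HasCompactSupport χ ∧ tsupport χ ⊆ Ioo 0 T ∧
      deriv χ = ψ := by
  obtain ⟨a, b, ha, hb, hab⟩ := exists_Icc_of_isCompact_subset_Ioo hT hs ht
  have hz : ∀ t, t ∉ Icc a b → ψ t = 0 := fun t h =>
    image_eq_zero_of_notMem_tsupport fun h' => h (hab h')
  have hd : ∀ t, HasDerivAt (fun t => ∫ s in (0 : ℝ)..t, ψ s) (ψ t) t := fun t =>
    intervalIntegral.integral_hasDerivAt_right (hψ.continuous.intervalIntegrable _ _)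
      (hψ.continuous.stronglyMeasurableAtFilter _ _) hψ.continuous.continuousAt
  have hderiv : deriv (fun t => ∫ s in (0 : ℝ)..t, ψ s) = ψ := funext fun t => (hd t).deriv
  have hsupp : Function.support (fun t => ∫ s in (0 : ℝ)..t, ψ s) ⊆ Icc a b := by
    intro t
    contrapose!
    intro h
    rw [Function.notMem_support]
    rcases lt_or_ge t a with h1 | h1
    · refine (intervalIntegral.integral_congr (g := fun _ => (0 : ℝ)) fun s hs' => ?_).trans
        (by simp)
      refine hz s fun h2 => ?_
      have : max 0 t < a := max_lt ha h1
      exact absurd hs'.2 (by simp only [not_le]; linarith [h2.1])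
    · have hbt : b < t := by
        by_contra! h2
        exact h ⟨h1, h2⟩
      rw [← h0]
      refine intervalIntegral.integral_eq_integral_of_support_subset fun s hs' => ?_
      have h3 : s ∈ Icc a b := by
        by_contra h4
        exact hs' (hz s h4)
      exact ⟨by linarith [h3.1], by linarith [h3.2]⟩
  have hts : tsupport (fun t => ∫ s in (0 : ℝ)..t, ψ s) ⊆ Icc a b :=
    closure_minimal hsupp isClosed_Icc
  refine ⟨_, ?_, HasCompactSupport.of_support_subset_isCompact isCompact_Icc hsupp,
    hts.trans fun x hx => ⟨by linarith [hx.1], by linarith [hx.2]⟩, hderiv⟩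
  rw [contDiff_infty_iff_deriv, hderiv]
  exact ⟨fun t => (hd t).differentiableAt, hψ⟩

/-- The lemma of du Bois-Reymond, for continuous functions. -/
theorem eqOn_const_of_weakDeriv_eq_zero {T : ℝ} (hT : 0 < T) {k : ℝ → ℝ}
    (hk : ContinuousOn k (Icc 0 T))
    (h : ∀ χ : ℝ → ℝ, ContDiff ℝ (⊤ : ℕ∞) χ → HasCompactSupport χ → tsupport χ ⊆ Ioo 0 T →
      ∫ t in Ioo 0 T, deriv χ t * k t = 0) :
    ∀ t ∈ Icc 0 T, k t = k 0 := by
  have hki : IntegrableOn k (Ioo 0 T) :=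
    hk.integrableOn_Icc.mono_set Ioo_subset_Icc_self
  have hTm : T / 2 ∈ Ioo 0 T := ⟨by linarith, by linarith⟩
  let bump : ContDiffBump (T / 2) := ⟨T / 8, T / 4, by linarith, by linarith⟩
  set ρ : ℝ → ℝ := bump.normed volume with hρ
  have hρc : ContDiff ℝ (⊤ : ℕ∞) ρ := bump.contDiff_normed
  have hρs : HasCompactSupport ρ := bump.hasCompactSupport_normed
  have hρt : tsupport ρ ⊆ Ioo 0 T := by
    rw [hρ, bump.tsupport_normed_eq, Real.closedBall_eq_Icc]
    intro x hx
    simp only [bump, mem_Icc] at hx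
    exact ⟨by linarith [hx.1], by linarith [hx.2]⟩
  have hρ1 : ∫ t, ρ t = 1 := bump.integral_normed
  have hmul : ∀ ψ : ℝ → ℝ, ContDiff ℝ (⊤ : ℕ∞) ψ → HasCompactSupport ψ →
      IntegrableOn (fun t => ψ t * k t) (Ioo 0 T) := fun ψ h1 h2 =>
    hki.integrable.locallyIntegrable.integrable_smul_left_of_hasCompactSupport h1.continuous h2
  set c : ℝ := ∫ t in Ioo 0 T, ρ t * k t with hc
  have key : ∀ᵐ t ∂(volume.restrict (Ioo 0 T)), t ∈ Ioo 0 T → k t - c = 0 := by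
    refine isOpen_Ioo.ae_eq_zero_of_integral_contDiff_smul_eq_zero
      ((hki.integrable.sub (integrable_const c)).locallyIntegrable.locallyIntegrableOn _)
      fun ψ h1 h2 h3 => ?_
    have h1i : Integrable ψ := h1.continuous.integrable_of_hasCompactSupport h2
    have hρi : Integrable ρ := hρc.continuous.integrable_of_hasCompactSupport hρs
    -- Subtracting a multiple of the bump `ρ` makes the integral vanish, so that the result is the
    -- derivative of a test function.
    have hsub : tsupport (fun t => ψ t - (∫ s, ψ s) * ρ t) ⊆ tsupport ψ ∪ tsupport ρ := by
      refine closure_minimal (fun t ht => ?_) ((isClosed_tsupport ψ).union (isClosed_tsupport ρ))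
      by_contra h4
      rw [mem_union, not_or] at h4
      exact ht (by simp [image_eq_zero_of_notMem_tsupport h4.1,
        image_eq_zero_of_notMem_tsupport h4.2])
    obtain ⟨χ, c1, c2, c3, c4⟩ := exists_test_primitive hT
      (ψ := fun t => ψ t - (∫ s, ψ s) * ρ t) (h1.sub (contDiff_const.mul hρc))
      (HasCompactSupport.intro (h2.isCompact.union hρs.isCompact) fun t ht =>
        image_eq_zero_of_notMem_tsupport (f := fun t => ψ t - (∫ s, ψ s) * ρ t)
          fun h' => ht (hsub h'))
      (hsub.trans (union_subset h3 hρt))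
      (by rw [integral_sub h1i (hρi.const_mul _), integral_const_mul, hρ1, mul_one, sub_self])
    have h5 := h χ c1 c2 c3
    have h6 : ∫ t in Ioo 0 T, ψ t = ∫ t, ψ t :=
      setIntegral_eq_integral_of_forall_compl_eq_zero fun t ht =>
        image_eq_zero_of_notMem_tsupport fun h' => ht (h3 h')
    have h7 : ∫ t in Ioo 0 T, deriv χ t * k t
        = (∫ t in Ioo 0 T, ψ t * k t) - (∫ s, ψ s) * c := by
      rw [c4, hc, ← integral_const_mul, ← integral_sub (hmul ψ h1 h2)
        ((hmul ρ hρc hρs).const_mul _)]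
      exact integral_congr_ae (Eventually.of_forall fun t => by ring)
    have h8 : ∫ t in Ioo 0 T, ψ t • (k t - c)
        = (∫ t in Ioo 0 T, ψ t * k t) - (∫ t in Ioo 0 T, ψ t) * c := by
      rw [← integral_mul_const, ← integral_sub (hmul ψ h1 h2) (h1i.integrableOn.mul_const _)]
      exact integral_congr_ae (Eventually.of_forall fun t => by simp only [smul_eq_mul]; ring)
    rw [h8, h6, ← h7, h5]
  have hIoo : EqOn k (fun _ => c) (Ioo 0 T) := by
    refine Measure.eqOn_open_of_ae_eq (μ := volume) ?_ isOpen_Ioo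
      (hk.mono Ioo_subset_Icc_self) continuousOn_const
    filter_upwards [key, ae_restrict_mem measurableSet_Ioo] with t h1 h2
    linarith [h1 h2]
  have hIcc : EqOn k (fun _ => c) (Icc 0 T) :=
    hIoo.of_subset_closure hk continuousOn_const Ioo_subset_Icc_self
      (by rw [closure_Ioo hT.ne])
  intro t ht
  rw [hIcc ht, hIcc ⟨le_rfl, hT.le⟩]

/-- A continuous function whose weak derivative on `(0, T)` is the integrable function `h` is a
primitive of `h`. -/
theorem eq_add_integral_of_weakDeriv {T : ℝ} (hT : 0 < T) {f h : ℝ → ℝ}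
    (hf : ContinuousOn f (Icc 0 T)) (hh : IntegrableOn h (Ioo 0 T))
    (hw : ∀ χ : ℝ → ℝ, ContDiff ℝ (⊤ : ℕ∞) χ → HasCompactSupport χ → tsupport χ ⊆ Ioo 0 T →
      ∫ t in Ioo 0 T, deriv χ t * f t = - ∫ t in Ioo 0 T, χ t * h t) :
    ∀ t ∈ Icc 0 T, f t = f 0 + ∫ s in (0 : ℝ)..t, h s := by
  have hi : IntervalIntegrable h volume 0 T :=
    (intervalIntegrable_iff_integrableOn_Ioo_of_le hT.le).2 hh
  have hu : uIcc 0 T = Icc 0 T := uIcc_of_le hT.le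
  have hac : AbsolutelyContinuousOnInterval (fun t => ∫ s in (0 : ℝ)..t, h s) 0 T :=
    hi.absolutelyContinuousOnInterval_intervalIntegral left_mem_uIcc
  have hHc : ContinuousOn (fun t => ∫ s in (0 : ℝ)..t, h s) (Icc 0 T) := hu ▸ hac.continuousOn
  have hconst := eqOn_const_of_weakDeriv_eq_zero hT (hf.sub hHc) fun χ h1 h2 h3 => by
    have hχd : Continuous (deriv χ) := h1.continuous_deriv (by simp)
    have hint : ∀ g : ℝ → ℝ, ContinuousOn g (Icc 0 T) →
        IntegrableOn (fun t => deriv χ t * g t) (Ioo 0 T) := fun g hg =>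
      ((hχd.continuousOn.mul hg).integrableOn_Icc).mono_set Ioo_subset_Icc_self
    have hχ0 : ∀ t, t ∉ Ioo 0 T → χ t = 0 := fun t ht =>
      image_eq_zero_of_notMem_tsupport fun h' => ht (h3 h')
    have hχac : AbsolutelyContinuousOnInterval χ 0 T :=
      (h1.of_le (by simp)).contDiffOn.absolutelyContinuousOnInterval
    have hparts := hac.integral_mul_deriv_eq_deriv_mul hχac
    rw [hχ0 0 (by simp), hχ0 T (by simp)] at hparts
    have e1 : ∫ t in Ioo 0 T, deriv χ t * ∫ s in (0 : ℝ)..t, h s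
        = - ∫ t in Ioo 0 T, χ t * h t := by
      rw [intervalIntegral.integral_of_le hT.le, integral_Ioc_eq_integral_Ioo] at hparts
      have e2 : ∫ t in (0 : ℝ)..T, deriv (fun t => ∫ s in (0 : ℝ)..t, h s) t * χ t
          = ∫ t in Ioo 0 T, χ t * h t := by
        rw [← integral_Ioc_eq_integral_Ioo, ← intervalIntegral.integral_of_le hT.le]
        refine intervalIntegral.integral_congr_ae ?_
        filter_upwards [hi.ae_hasDerivAt_integral] with t ht htm
        rw [(ht (uIoc_subset_uIcc htm) 0 left_mem_uIcc).deriv, mul_comm]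
      rw [e2] at hparts
      simp only [mul_comm (deriv χ _)]
      linarith
    have e3 : ∫ t in Ioo 0 T, deriv χ t * (f t - ∫ s in (0 : ℝ)..t, h s)
        = (∫ t in Ioo 0 T, deriv χ t * f t)
          - ∫ t in Ioo 0 T, deriv χ t * ∫ s in (0 : ℝ)..t, h s := by
      rw [← integral_sub (hint _ hf) (hint _ hHc)]
      simp only [mul_sub]
    exact e3.trans (by rw [hw χ h1 h2 h3, e1, sub_self])
  intro t ht
  have := hconst t ht
  simp only [Pi.sub_apply, intervalIntegral.integral_same] at this
  linarith

/-! ### A Grönwall lemma for primitives in a Hilbert space -/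

theorem absolutelyContinuousOnInterval_of_dist_le {X Y : Type*} [PseudoMetricSpace X]
    [PseudoMetricSpace Y] {f : ℝ → X} {g : ℝ → Y} {a b : ℝ} (C : ℝ)
    (hg : AbsolutelyContinuousOnInterval g a b)
    (h : ∀ s ∈ uIcc a b, ∀ t ∈ uIcc a b, dist (f s) (f t) ≤ C * dist (g s) (g t)) :
    AbsolutelyContinuousOnInterval f a b := by
  have h0 := Tendsto.const_mul C hg
  rw [mul_zero] at h0
  refine squeeze_zero' (Eventually.of_forall fun E => Finset.sum_nonneg fun _ _ => dist_nonneg)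
    ?_ h0
  filter_upwards [mem_inf_of_right (mem_principal_self _)] with E hE
  rw [Finset.mul_sum]
  exact Finset.sum_le_sum fun i hi => h _ (hE.1 i hi).1 _ (hE.1 i hi).2

/-- The squared norm of a primitive is absolutely continuous. -/
theorem absolutelyContinuousOnInterval_norm_sq_integral {E : Type*} [NormedAddCommGroup E]
    [NormedSpace ℝ E] [CompleteSpace E] {z : ℝ → E} {T : ℝ}
    (hz : IntervalIntegrable z volume 0 T) :
    AbsolutelyContinuousOnInterval (fun t => ‖∫ s in (0 : ℝ)..t, z s‖ ^ 2) 0 T := by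
  have hsub : ∀ s ∈ uIcc 0 T, ∀ t ∈ uIcc 0 T, IntervalIntegrable z volume s t := fun s hs t ht =>
    hz.mono_set (uIcc_subset_uIcc hs ht)
  have hN := hz.norm.absolutelyContinuousOnInterval_intervalIntegral left_mem_uIcc
  have hdist : ∀ s ∈ uIcc 0 T, ∀ t ∈ uIcc 0 T,
      dist (∫ r in (0 : ℝ)..s, z r) (∫ r in (0 : ℝ)..t, z r)
        ≤ 1 * dist (∫ r in (0 : ℝ)..s, ‖z r‖) (∫ r in (0 : ℝ)..t, ‖z r‖) := by
    intro s hs t ht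
    rw [dist_eq_norm, Real.dist_eq, one_mul, intervalIntegral.integral_interval_sub_left
      (hsub 0 left_mem_uIcc s hs) (hsub 0 left_mem_uIcc t ht),
      intervalIntegral.integral_interval_sub_left
      (hsub 0 left_mem_uIcc s hs).norm (hsub 0 left_mem_uIcc t ht).norm]
    exact intervalIntegral.norm_integral_le_abs_integral_norm
  have hV : AbsolutelyContinuousOnInterval (fun t => ∫ s in (0 : ℝ)..t, z s) 0 T :=
    absolutelyContinuousOnInterval_of_dist_le 1 hN hdist
  obtain ⟨B, hB⟩ := hV.exists_bound
  -- On the ball of radius `B` the squared norm is Lipschitz with constant `2 * B`.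
  refine absolutelyContinuousOnInterval_of_dist_le (2 * B) hV fun s hs t ht => ?_
  have h1 := hB s hs
  have h2 := hB t ht
  have h3 := abs_norm_sub_norm_le (∫ r in (0 : ℝ)..s, z r) (∫ r in (0 : ℝ)..t, z r)
  rw [Real.dist_eq, dist_eq_norm, sq_sub_sq, abs_mul, abs_of_nonneg (by positivity)]
  exact mul_le_mul (by linarith) h3 (abs_nonneg _)
    (by linarith [norm_nonneg (∫ r in (0 : ℝ)..s, z r)])

/-- If `V' = z` and `(V, z) ≤ C |V|²` almost everywhere, and `V(0) = 0`, then `V = 0`: the function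
`exp (-2 C t) |V(t)|²` is absolutely continuous with nonpositive derivative. -/
theorem integral_eq_zero_of_inner_le {E : Type*} [NormedAddCommGroup E] [InnerProductSpace ℝ E]
    [CompleteSpace E] {z : ℝ → E} {T C : ℝ} (hz : IntegrableOn z (Ioo 0 T))
    (h : ∀ᵐ t ∂(volume.restrict (Ioo 0 T)),
      inner ℝ (∫ s in (0 : ℝ)..t, z s) (z t) ≤ C * ‖∫ s in (0 : ℝ)..t, z s‖ ^ 2) :
    ∀ t ∈ Icc 0 T, ∫ s in (0 : ℝ)..t, z s = 0 := by
  intro t ht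
  have hi : IntervalIntegrable z volume 0 t :=
    (intervalIntegrable_iff_integrableOn_Ioo_of_le ht.1).2
      (hz.mono_set (Ioo_subset_Ioo_right ht.2))
  have hexp : AbsolutelyContinuousOnInterval (fun s => Real.exp (-(2 * C) * s)) 0 t :=
    ContDiffOn.absolutelyContinuousOnInterval (by fun_prop)
  have hac := hexp.fun_mul (absolutelyContinuousOnInterval_norm_sq_integral hi)
  have hftc := hac.integral_deriv_eq_sub
  have hle : ∫ s in (0 : ℝ)..t, deriv
      (fun s => Real.exp (-(2 * C) * s) * ‖∫ r in (0 : ℝ)..s, z r‖ ^ 2) s ≤ 0 := by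
    rw [intervalIntegral.integral_of_le ht.1, integral_Ioc_eq_integral_Ioo]
    refine setIntegral_nonpos_of_ae_restrict ?_
    filter_upwards [ae_restrict_of_ae_restrict_of_subset (Ioo_subset_Ioo_right ht.2) h,
      ae_restrict_of_ae hi.ae_hasDerivAt_integral, ae_restrict_mem measurableSet_Ioo]
      with s h1 h2 h3
    have hs : s ∈ uIcc 0 t := by
      rw [uIcc_of_le ht.1]
      exact Ioo_subset_Icc_self h3
    have hd := (((hasDerivAt_id s).const_mul (-(2 * C))).exp).mul
      (h2 hs 0 left_mem_uIcc).norm_sq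
    have hd' : deriv (fun s => Real.exp (-(2 * C) * s) * ‖∫ r in (0 : ℝ)..s, z r‖ ^ 2) s = _ :=
      hd.deriv
    rw [hd']
    have hpos := Real.exp_pos (-(2 * C) * s)
    simp only [id, mul_one, Pi.zero_apply]
    nlinarith
  rw [hftc] at hle
  simp only [intervalIntegral.integral_same, norm_zero] at hle
  have hpos := Real.exp_pos (-(2 * C) * t)
  have h0 : ‖∫ r in (0 : ℝ)..t, z r‖ ^ 2 ≤ 0 := by
    by_contra! hlt
    nlinarith [mul_pos hpos hlt]
  exact norm_eq_zero.1 (pow_eq_zero_iff two_ne_zero |>.1 (le_antisymm h0 (sq_nonneg _)))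

/-! ### The Sobolev space -/

/-- The weak gradient of the zero function vanishes, so a Sobolev function is determined by its
class in `L²(Ω)`. -/
theorem H1.toL2_injective {d : ℕ} {Ω : Set (Euc d)} (hΩ : IsOpen Ω) :
    Function.Injective (H1.toL2 Ω) := by
  refine (injective_iff_map_eq_zero _).2 fun u hu => ?_
  have hw : IsWeakGradient Ω (H1.toL2 Ω u) (H1.grad Ω u) := u.2
  have hv : ∀ v : Euc d, ∀ᵐ x ∂(volume.restrict Ω), x ∈ Ω → inner ℝ (H1.grad Ω u x) v = 0 := by
    intro v
    refine hΩ.ae_eq_zero_of_integral_contDiff_smul_eq_zero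
      ((((Lp.memLp (H1.grad Ω u)).inner_const (𝕜 := ℝ) v).locallyIntegrable
        (by norm_num)).locallyIntegrableOn _) fun η h1 h2 h3 => ?_
    have h4 := hw η h1 h2 h3 v
    have h5 : ∫ x in Ω, H1.toL2 Ω u x * fderiv ℝ η x v = 0 := by
      refine integral_eq_zero_of_ae ?_
      rw [hu]
      filter_upwards [Lp.coeFn_zero ℝ 2 (volume.restrict Ω)] with x hx
      rw [hx]; simp
    rw [h5, zero_eq_neg] at h4
    simpa only [smul_eq_mul, mul_comm (η _)] using h4
  have hg : H1.grad Ω u = 0 := by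
    refine Lp.ext ?_
    filter_upwards [ae_all_iff.2 fun i => hv (EuclideanSpace.single i 1),
      Lp.coeFn_zero (Euc d) 2 (volume.restrict Ω), ae_restrict_mem hΩ.measurableSet]
      with x hx h0 hxΩ
    rw [h0]
    ext i
    simpa [EuclideanSpace.inner_single_right] using hx i hxΩ
  have : (u.1 : WithLp 2 (L2 Ω × L2vec Ω)) = 0 := by
    apply WithLp.ofLp_injective
    exact Prod.ext hu hg
  exact Subtype.ext this

/-! ### The gradient of the anisotropy -/

theorem IsAdmissibleAnisotropy.continuous_gradient {d : ℕ} {A : Euc d → ℝ}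
    (hA : IsAdmissibleAnisotropy A) : Continuous (gradient A) :=
  (InnerProductSpace.toDual ℝ (Euc d)).symm.continuous.comp
    (hA.contDiff.continuous_fderiv one_ne_zero)

theorem IsAdmissibleAnisotropy.gradient_smul {d : ℕ} {A : Euc d → ℝ}
    (hA : IsAdmissibleAnisotropy A) {l : ℝ} (hl : 0 < l) (p : Euc d) :
    gradient A (l • p) = l • gradient A p := by
  have h1 : l • fderiv ℝ A (l • p) = l ^ 2 • fderiv ℝ A p := by
    rw [← fderiv_comp_smul, ← fderiv_const_smul (hA.contDiff.differentiable one_ne_zero p)]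
    congr 1
    funext q
    simp [hA.homogeneous l q hl]
  have h2 : fderiv ℝ A (l • p) = l • fderiv ℝ A p := by
    rw [pow_two, mul_smul] at h1
    exact smul_right_injective _ hl.ne' h1
  simp only [gradient, h2, map_smul]

theorem IsAdmissibleAnisotropy.exists_norm_gradient_le {d : ℕ} {A : Euc d → ℝ}
    (hA : IsAdmissibleAnisotropy A) : ∃ K : ℝ, ∀ p, ‖gradient A p‖ ≤ K * ‖p‖ := by
  obtain ⟨K, hK⟩ := (isCompact_sphere (0 : Euc d) 1).exists_bound_of_continuousOn
    hA.continuous_gradient.continuousOn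
  refine ⟨K, fun p => ?_⟩
  rcases eq_or_ne p 0 with rfl | hp
  · have h := hA.gradient_smul two_pos (0 : Euc d)
    rw [smul_zero, two_smul, left_eq_add] at h
    simp [h]
  · have hp' : 0 < ‖p‖ := norm_pos_iff.2 hp
    have h := hA.gradient_smul hp' (‖p‖⁻¹ • p)
    rw [smul_inv_smul₀ hp'.ne'] at h
    rw [h, norm_smul, norm_norm, mul_comm]
    gcongr
    refine hK _ ?_
    simp [norm_smul, hp'.ne']

/-- The gradient of the anisotropy grows linearly, hence acts on `L²(Ω; ℝ^d)`. -/
theorem IsAdmissibleAnisotropy.memLp_gradient {d : ℕ} {A : Euc d → ℝ}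
    (hA : IsAdmissibleAnisotropy A) {Ω : Set (Euc d)} (G : L2vec Ω) :
    MemLp (fun x => gradient A (G x)) 2 (volume.restrict Ω) := by
  obtain ⟨K, hK⟩ := hA.exists_norm_gradient_le
  exact (Lp.memLp G).of_le_mul
    (hA.continuous_gradient.comp_aestronglyMeasurable (Lp.aestronglyMeasurable G))
    (Eventually.of_forall fun x => hK (G x))

/-! ### One-sided Lipschitz potentials -/

theorem HasConvexSplitting.exists_deriv_sub_mul_ge {F : ℝ → ℝ} (hF : HasConvexSplitting F) :
    ∃ L : ℝ, ∀ a b, -L * (a - b) ^ 2 ≤ (deriv F a - deriv F b) * (a - b) := by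
  obtain ⟨F₁, F₂, h1, h2, hs, hc, L, hL⟩ := hF
  have d1 : Differentiable ℝ F₁ := h1.differentiable two_ne_zero
  have d2 : Differentiable ℝ F₂ := h2.differentiable two_ne_zero
  have hd : ∀ a, deriv F a = deriv F₁ a + deriv F₂ a := fun a => by
    rw [funext hs]
    exact deriv_fun_add (d1 a) (d2 a)
  have hm : Monotone (deriv F₁) := monotoneOn_univ.1 (hc.monotoneOn_deriv fun x _ => d1 x)
  refine ⟨L, fun a b => ?_⟩
  have m1 : 0 ≤ (deriv F₁ a - deriv F₁ b) * (a - b) := by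
    rcases le_total a b with h | h
    · exact mul_nonneg_of_nonpos_of_nonpos (sub_nonpos.2 (hm h)) (sub_nonpos.2 h)
    · exact mul_nonneg (sub_nonneg.2 (hm h)) (sub_nonneg.2 h)
  have m2 : |deriv F₂ a - deriv F₂ b| ≤ L * |a - b| := hL.dist_le_mul a b
  have m3 : |(deriv F₂ a - deriv F₂ b) * (a - b)| ≤ L * (a - b) ^ 2 := by
    rw [abs_mul, ← sq_abs, pow_two, ← mul_assoc]
    gcongr
  rw [hd, hd]
  linarith [(abs_le.1 m3).1]

theorem hasDerivAt_logPotential (θ θc : ℝ) {s : ℝ} (hs : |s| < 1) :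
    HasDerivAt (logPotential θ θc)
      (θ / 2 * (Real.log (1 + s) - Real.log (1 - s)) - θc * s) s := by
  obtain ⟨h1, h2⟩ := abs_lt.1 hs
  have p1 : 1 + s ≠ 0 := by linarith
  have p2 : 1 - s ≠ 0 := by linarith
  have e1 := (Real.hasDerivAt_mul_log p1).comp s ((hasDerivAt_id s).const_add 1)
  have e2 := (Real.hasDerivAt_mul_log p2).comp s ((hasDerivAt_id s).const_sub 1)
  have e3 := ((hasDerivAt_id s).pow 2).const_sub 1
  have e := ((e1.add e2).const_mul (θ / 2)).add (e3.const_mul (θc / 2))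
  refine HasDerivAt.congr_deriv e ?_
  simp
  ring

theorem deriv_logPotential_sub_mul_ge {θ θc : ℝ} (hθ : 0 < θ) {a b : ℝ} (ha : |a| < 1)
    (hb : |b| < 1) :
    -θc * (a - b) ^ 2 ≤
      (deriv (logPotential θ θc) a - deriv (logPotential θ θc) b) * (a - b) := by
  rw [(hasDerivAt_logPotential θ θc ha).deriv, (hasDerivAt_logPotential θ θc hb).deriv]
  obtain ⟨a1, a2⟩ := abs_lt.1 ha
  obtain ⟨b1, b2⟩ := abs_lt.1 hb
  have key : 0 ≤ (Real.log (1 + a) - Real.log (1 + b)) * (a - b)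
      ∧ 0 ≤ (Real.log (1 - b) - Real.log (1 - a)) * (a - b) := by
    rcases le_total a b with h | h
    · exact ⟨mul_nonneg_of_nonpos_of_nonpos
        (sub_nonpos.2 (Real.log_le_log (by linarith) (by linarith))) (sub_nonpos.2 h),
        mul_nonneg_of_nonpos_of_nonpos
        (sub_nonpos.2 (Real.log_le_log (by linarith) (by linarith))) (sub_nonpos.2 h)⟩
    · exact ⟨mul_nonneg
        (sub_nonneg.2 (Real.log_le_log (by linarith) (by linarith))) (sub_nonneg.2 h),
        mul_nonneg
        (sub_nonneg.2 (Real.log_le_log (by linarith) (by linarith))) (sub_nonneg.2 h)⟩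
  have := mul_nonneg (half_pos hθ).le (add_nonneg key.1 key.2)
  linarith

/-! ### The potential equation in `L²` -/

/-- Pointwise coercivity of a pairing implies coercivity in `L²`. -/
theorem mul_norm_sq_le_inner {α E : Type*} [MeasurableSpace α] {ν : Measure α}
    [NormedAddCommGroup E] [InnerProductSpace ℝ E] {c : ℝ} {f g : Lp E 2 ν}
    (h : ∀ᵐ x ∂ν, c * ‖g x‖ ^ 2 ≤ inner ℝ (f x) (g x)) :
    c * ‖g‖ ^ 2 ≤ inner ℝ f g := by
  rw [← real_inner_self_eq_norm_sq, L2.inner_def, L2.inner_def, ← integral_const_mul]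
  refine integral_mono_ae ((L2.integrable_inner g g).const_mul c) (L2.integrable_inner f g) ?_
  filter_upwards [h] with x hx
  simpa only [real_inner_self_eq_norm_sq] using hx

/-- The second equation as an identity between `L²` inner products; `a` is `A'(∇φ)` and `f` is
`F'(φ)`. -/
theorem SolvesWeakly.potential_inner {d : ℕ} {Ω : Set (Euc d)} {T : ℝ} {A : Euc d → ℝ}
    {M : Euc d → ℝ → ℝ} {F : ℝ → ℝ} {φ₀ : H1 Ω} {φ : ℝ → L2 Ω} {Φ μ : ℝ → H1 Ω}
    (h : SolvesWeakly Ω T A M F φ₀ φ Φ μ) (hA : IsAdmissibleAnisotropy A) :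
    ∀ᵐ t ∂(volume.restrict (Ioo 0 T)), ∃ (a : L2vec Ω) (f : L2 Ω),
      (∀ᵐ x ∂(volume.restrict Ω), a x = gradient A (H1.grad Ω (Φ t) x)) ∧
      (∀ᵐ x ∂(volume.restrict Ω), f x = deriv F (φ t x)) ∧
      ∀ η : H1 Ω, inner ℝ (H1.toL2 Ω (μ t)) (H1.toL2 Ω η)
        = inner ℝ a (H1.grad Ω η) + inner ℝ f (H1.toL2 Ω η) := by
  obtain ⟨w, -, hw⟩ := h.memLp_deriv
  filter_upwards [hw, h.potential] with t hwt hp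
  have ha := (hA.memLp_gradient (H1.grad Ω (Φ t))).coeFn_toLp
  refine ⟨_, w t, ha, hwt, fun η => ?_⟩
  rw [L2.inner_def, L2.inner_def, L2.inner_def,
    ← integral_add (L2.integrable_inner _ _) (L2.integrable_inner _ _)]
  refine Eq.trans ?_ ((hp η).trans ?_)
  · exact integral_congr_ae (Eventually.of_forall fun x => by simp [mul_comm])
  · refine integral_congr_ae ?_
    filter_upwards [ha, hwt] with x h1 h2
    rw [h1, ← h2]
    simp [mul_comm]

/-! ### The weak equations and uniqueness -/

variable {d : ℕ} {Ω : Set (Euc d)} {T m : ℝ} {A : Euc d → ℝ} {M : Euc d → ℝ → ℝ} {F : ℝ → ℝ}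
  {φ₀ : H1 Ω} {φ φ' : ℝ → L2 Ω} {Φ Φ' μ μ' : ℝ → H1 Ω}

theorem SolvesWeakly.integrableOn_grad (h : SolvesWeakly Ω T A M F φ₀ φ Φ μ) :
    IntegrableOn (fun t => H1.grad Ω (μ t)) (Ioo 0 T) :=
  ((H1.grad Ω).comp_memLp' h.memLp_potential).integrable one_le_two

/-- The first equation for constant mobility `m`, integrated in time: in the weak sense,
`φ(t) - φ₀` is the divergence of `m ∫_0^t ∇μ`. -/
theorem SolvesWeakly.inner_eq (h : SolvesWeakly Ω T A M F φ₀ φ Φ μ) (hT : 0 < T)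
    (hM : ∀ p s, M p s = m) (ζ : H1 Ω) {t : ℝ} (ht : t ∈ Icc 0 T) :
    inner ℝ (φ t) (H1.toL2 Ω ζ) = inner ℝ (H1.toL2 Ω φ₀) (H1.toL2 Ω ζ)
      - m * inner ℝ (∫ s in (0 : ℝ)..t, H1.grad Ω (μ s)) (H1.grad Ω ζ) := by
  obtain ⟨dφ, ⟨hd, hweak⟩, hev⟩ := h.evolution
  have hg := h.integrableOn_grad
  have hev' : ∀ᵐ s ∂(volume.restrict (Ioo 0 T)),
      dφ s ζ = -m * inner ℝ (H1.grad Ω (μ s)) (H1.grad Ω ζ) := by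
    filter_upwards [hev] with s hs
    rw [hs ζ, L2.inner_def, ← integral_const_mul, ← integral_neg]
    simp only [hM, neg_mul]
  have hdc : ContinuousOn (fun s => L2.toDual Ω (φ s)) (Icc 0 T) :=
    ((innerSL ℝ).continuous.comp_continuousOn h.continuousOn).clm_comp continuousOn_const
  have hprim := eq_add_integral_of_weakDeriv hT
    (f := fun s => inner ℝ (φ s) (H1.toL2 Ω ζ))
    (h := fun s => -m * inner ℝ (H1.grad Ω (μ s)) (H1.grad Ω ζ))
    (h.continuousOn.inner continuousOn_const)
    ((hg.integrable.inner_const (𝕜 := ℝ) (H1.grad Ω ζ)).const_mul (-m))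
    (fun χ c1 c2 c3 => by
      have hw := congrArg (fun l : H1Dual Ω => l ζ) (hweak χ c1 c2 c3)
      have i1 : Integrable (fun s => deriv χ s • L2.toDual Ω (φ s))
          (volume.restrict (Ioo 0 T)) :=
        (((c1.continuous_deriv (by simp)).continuousOn.smul hdc).integrableOn_Icc).mono_set
          Ioo_subset_Icc_self
      have i2 : Integrable (fun s => χ s • dφ s) (volume.restrict (Ioo 0 T)) :=
        (hd.integrable one_le_two).locallyIntegrable.integrable_smul_left_of_hasCompactSupport
          c1.continuous c2
      simp only [neg_apply, ContinuousLinearMap.integral_apply i1,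
        ContinuousLinearMap.integral_apply i2] at hw
      refine hw.trans (congrArg Neg.neg (integral_congr_ae ?_))
      filter_upwards [hev'] with s hs
      rw [smul_apply, hs, smul_eq_mul]) t ht
  have hi : IntervalIntegrable (fun s => H1.grad Ω (μ s)) volume 0 t :=
    (intervalIntegrable_iff_integrableOn_Ioo_of_le ht.1).2
      (hg.mono_set (Ioo_subset_Ioo_right ht.2))
  have hin : ∫ s in (0 : ℝ)..t, inner ℝ (H1.grad Ω (μ s)) (H1.grad Ω ζ)
      = inner ℝ (∫ s in (0 : ℝ)..t, H1.grad Ω (μ s)) (H1.grad Ω ζ) := by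
    rw [real_inner_comm, ← innerSL_apply_apply ℝ,
      ← ContinuousLinearMap.intervalIntegral_comp_comm _ hi]
    simp only [innerSL_apply_apply, real_inner_comm]
  simp only [intervalIntegral.integral_const_mul, hin, h.initial] at hprim
  linarith

/-- The second equation tested with the difference of two solutions. -/
theorem SolvesWeakly.potential_coercive {L : ℝ} (h : SolvesWeakly Ω T A M F φ₀ φ Φ μ)
    (h' : SolvesWeakly Ω T A M F φ₀ φ' Φ' μ') (hA : IsAdmissibleAnisotropy A) {a₀ : ℝ}
    (ha₀ : ∀ p q : Euc d, a₀ * ‖p - q‖ ^ 2 ≤ inner ℝ (gradient A p - gradient A q) (p - q))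
    (hL : ∀ᵐ t ∂(volume.restrict (Ioo 0 T)), ∀ᵐ x ∂(volume.restrict Ω),
      -L * (φ t x - φ' t x) ^ 2 ≤ (deriv F (φ t x) - deriv F (φ' t x)) * (φ t x - φ' t x)) :
    ∀ᵐ t ∂(volume.restrict (Ioo 0 T)),
      a₀ * ‖H1.grad Ω (Φ t - Φ' t)‖ ^ 2 - L * ‖φ t - φ' t‖ ^ 2
        ≤ inner ℝ (φ t - φ' t) (H1.toL2 Ω (μ t - μ' t)) := by
  filter_upwards [h.potential_inner hA, h'.potential_inner hA, h.eq_ae, h'.eq_ae, hL]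
    with t hp hp' he he' hLt
  obtain ⟨a, f, ha, hf, hp⟩ := hp
  obtain ⟨a', f', ha', hf', hp'⟩ := hp'
  have h1 := hp (Φ t - Φ' t)
  have h2 := hp' (Φ t - Φ' t)
  have h3 : a₀ * ‖H1.grad Ω (Φ t - Φ' t)‖ ^ 2 ≤ inner ℝ (a - a') (H1.grad Ω (Φ t - Φ' t)) := by
    refine mul_norm_sq_le_inner ?_
    rw [map_sub]
    filter_upwards [ha, ha', Lp.coeFn_sub a a',
      Lp.coeFn_sub (H1.grad Ω (Φ t)) (H1.grad Ω (Φ' t))] with x x1 x2 x3 x4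
    rw [x3, x4, Pi.sub_apply, Pi.sub_apply, x1, x2]
    exact ha₀ _ _
  have h4 : -L * ‖φ t - φ' t‖ ^ 2 ≤ inner ℝ (f - f') (φ t - φ' t) := by
    refine mul_norm_sq_le_inner ?_
    filter_upwards [hf, hf', Lp.coeFn_sub f f', Lp.coeFn_sub (φ t) (φ' t), hLt]
      with x x1 x2 x3 x4 x5
    rw [x3, x4, Pi.sub_apply, Pi.sub_apply, x1, x2, Real.norm_eq_abs, sq_abs]
    simpa [mul_comm] using x5
  rw [map_sub (H1.toL2 Ω), he, he'] at h1 h2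
  rw [map_sub (H1.toL2 Ω), real_inner_comm, inner_sub_left, h1, h2]
  rw [inner_sub_left] at h3 h4
  linarith

/-- Completing the square: the bound that closes the Grönwall argument. -/
theorem le_mul_sq_of_energy_estimate {a₀ L m D V S P : ℝ} (ha₀ : 0 < a₀) (hm : 0 < m)
    (hS : 0 ≤ S) (hSle : S ≤ m * (V * D))
    (h : a₀ * D ^ 2 - L * S ≤ -(m * P)) : P ≤ |L| ^ 2 * m / (4 * a₀) * V ^ 2 := by
  have h1 : L * S ≤ |L| * (m * (V * D)) :=
    (mul_le_mul_of_nonneg_right (le_abs_self L) hS).trans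
      (mul_le_mul_of_nonneg_left hSle (abs_nonneg L))
  have h2 : 4 * a₀ * (m * P) ≤ (|L| * m * V) ^ 2 := by
    nlinarith [sq_nonneg (2 * a₀ * D - |L| * m * V)]
  rw [div_mul_eq_mul_div, le_div_iff₀ (by positivity)]
  refine le_of_mul_le_mul_left ?_ hm
  linarith

/-- Uniqueness whenever `F'` is one-sided Lipschitz along the two solutions. Once the primitive of
the difference of the `∇μ` vanishes, the first equation gives `φ = φ'`, and then the second one
identifies the potentials. -/
theorem samePair_of_solvesWeakly {L : ℝ} (hΩ : IsOpen Ω) (hT : 0 < T) (hm : 0 < m)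
    (hM : ∀ p s, M p s = m) (hA : IsAdmissibleAnisotropy A)
    (h : SolvesWeakly Ω T A M F φ₀ φ Φ μ) (h' : SolvesWeakly Ω T A M F φ₀ φ' Φ' μ')
    (hL : ∀ᵐ t ∂(volume.restrict (Ioo 0 T)), ∀ᵐ x ∂(volume.restrict Ω),
      -L * (φ t x - φ' t x) ^ 2 ≤ (deriv F (φ t x) - deriv F (φ' t x)) * (φ t x - φ' t x)) :
    SamePair Ω T φ φ' μ μ' := by
  obtain ⟨a₀, ha₀, hmono⟩ := hA.stronglyMonotone
  set z : ℝ → L2vec Ω := fun t => H1.grad Ω (μ t - μ' t) with hz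
  have hzsub : z = fun t => H1.grad Ω (μ t) - H1.grad Ω (μ' t) := by
    simp only [hz, map_sub]
  have hzi : IntegrableOn z (Ioo 0 T) := by
    rw [hzsub]
    exact h.integrableOn_grad.sub h'.integrableOn_grad
  have hi : ∀ {μ : ℝ → H1 Ω} {t : ℝ}, t ∈ Icc 0 T →
      IntegrableOn (fun t => H1.grad Ω (μ t)) (Ioo 0 T) →
      IntervalIntegrable (fun s => H1.grad Ω (μ s)) volume 0 t := fun ht hg =>
    (intervalIntegrable_iff_integrableOn_Ioo_of_le ht.1).2
      (hg.mono_set (Ioo_subset_Ioo_right ht.2))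
  have hrep : ∀ t ∈ Icc 0 T, ∀ ζ : H1 Ω, inner ℝ (φ t - φ' t) (H1.toL2 Ω ζ)
      = -m * inner ℝ (∫ s in (0 : ℝ)..t, z s) (H1.grad Ω ζ) := by
    intro t ht ζ
    rw [hzsub, intervalIntegral.integral_sub (hi ht h.integrableOn_grad)
      (hi ht h'.integrableOn_grad), inner_sub_left, inner_sub_left, h.inner_eq hT hM ζ ht,
      h'.inner_eq hT hM ζ ht]
    ring
  have hV : ∀ t ∈ Icc 0 T, ∫ s in (0 : ℝ)..t, z s = 0 := by
    refine integral_eq_zero_of_inner_le (C := |L| ^ 2 * m / (4 * a₀)) hzi ?_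
    filter_upwards [h.potential_coercive h' hA hmono hL, h.eq_ae, h'.eq_ae,
      ae_restrict_mem measurableSet_Ioo] with t hc he he' ht
    have ht' := Ioo_subset_Icc_self ht
    rw [hrep t ht', neg_mul] at hc
    refine le_mul_sq_of_energy_estimate ha₀ hm (sq_nonneg _) ?_ hc
    -- The interpolation `|u|² ≤ m |V| |∇u|` comes from testing with `ζ = u`.
    have hs := hrep t ht' (Φ t - Φ' t)
    rw [map_sub (H1.toL2 Ω), he, he', real_inner_self_eq_norm_sq] at hs
    rw [hs, neg_mul, ← mul_neg]
    refine mul_le_mul_of_nonneg_left ?_ hm.le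
    exact (neg_le_abs _).trans (abs_real_inner_le_norm _ _)
  have hφae : φ =ᵐ[volume.restrict (Ioo 0 T)] φ' := by
    filter_upwards [h.eq_ae, h'.eq_ae, ae_restrict_mem measurableSet_Ioo] with t he he' ht
    have ht' := Ioo_subset_Icc_self ht
    have hs := hrep t ht' (Φ t - Φ' t)
    rw [hV t ht', inner_zero_left, mul_zero, map_sub, he, he', inner_self_eq_zero] at hs
    exact sub_eq_zero.1 hs
  refine ⟨?_, ?_⟩
  · exact (Measure.eqOn_open_of_ae_eq (μ := volume) hφae isOpen_Ioo
      (h.continuousOn.mono Ioo_subset_Icc_self)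
      (h'.continuousOn.mono Ioo_subset_Icc_self)).of_subset_closure
      h.continuousOn h'.continuousOn Ioo_subset_Icc_self (by rw [closure_Ioo hT.ne])
  · filter_upwards [h.potential, h'.potential, h.eq_ae, h'.eq_ae, hφae] with t hp hp' he he' hφ
    have hΦ : Φ t = Φ' t := H1.toL2_injective hΩ (by rw [he, he', hφ])
    have hin : ∀ (ν η : H1 Ω), inner ℝ (H1.toL2 Ω ν) (H1.toL2 Ω η)
        = ∫ x in Ω, H1.toL2 Ω ν x * H1.toL2 Ω η x := fun ν η => by
      rw [L2.inner_def]
      exact integral_congr_ae (Eventually.of_forall fun x => by simp [mul_comm])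
    have heq : ∀ η : H1 Ω, inner ℝ (H1.toL2 Ω (μ t)) (H1.toL2 Ω η)
        = inner ℝ (H1.toL2 Ω (μ' t)) (H1.toL2 Ω η) := fun η => by
      rw [hin, hin, hp, hp', hΦ, hφ]
    have h0 := heq (μ t - μ' t)
    rw [← sub_eq_zero, ← inner_sub_left, ← map_sub, inner_self_eq_zero] at h0
    exact sub_eq_zero.1 ((map_eq_zero_iff _ (H1.toL2_injective hΩ)).1 h0)

end AnisoCH

theorem mainTheorem2 {d : ℕ} (hd : d = 2 ∨ d = 3)
    (Ω : Set (AnisoCH.Euc d)) (hΩ : AnisoCH.IsBoundedLipschitzDomain Ω)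
    (T : ℝ) (hT : 0 < T)
    (A : AnisoCH.Euc d → ℝ) (hA : AnisoCH.IsAdmissibleAnisotropy A)
    (M : AnisoCH.Euc d → ℝ → ℝ) (hM : AnisoCH.IsAdmissibleMobility M)
    (hMconst : ∃ m : ℝ, ∀ p s, M p s = m)
    (φ₀ : AnisoCH.H1 Ω) :
    (∀ F : ℝ → ℝ, AnisoCH.IsRegularPotential F → AnisoCH.HasConvexSplitting F →
      ∀ (φ φ' : ℝ → AnisoCH.L2 Ω) (μ μ' : ℝ → AnisoCH.H1 Ω),
        AnisoCH.IsWeakSolution Ω T A M F φ₀ φ μ →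
        AnisoCH.IsWeakSolution Ω T A M F φ₀ φ' μ' →
        AnisoCH.SamePair Ω T φ φ' μ μ') ∧
    (∀ θ θc : ℝ, 0 < θ →
      (∀ᵐ x ∂(volume.restrict Ω), |AnisoCH.H1.toL2 Ω φ₀ x| ≤ 1) →
      |⨍ x in Ω, AnisoCH.H1.toL2 Ω φ₀ x| < 1 →
      ∀ (φ φ' : ℝ → AnisoCH.L2 Ω) (μ μ' : ℝ → AnisoCH.H1 Ω),
        AnisoCH.IsLogWeakSolution Ω T A M θ θc φ₀ φ μ →
        AnisoCH.IsLogWeakSolution Ω T A M θ θc φ₀ φ' μ' →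
        AnisoCH.SamePair Ω T φ φ' μ μ') := by
  obtain ⟨m, hm⟩ := hMconst
  have hmpos : 0 < m := by
    obtain ⟨M₀, M₁, h0, -, hb⟩ := hM.bounds
    exact h0.trans_le (hm 0 0 ▸ (hb 0 0).1)
  refine ⟨?_, ?_⟩
  · rintro F - hF φ φ' μ μ' ⟨Φ, h, -⟩ ⟨Φ', h', -⟩
    obtain ⟨L, hL⟩ := hF.exists_deriv_sub_mul_ge
    exact AnisoCH.samePair_of_solvesWeakly hΩ.isOpen hT hmpos hm hA h h'
      (Filter.Eventually.of_forall fun t => Filter.Eventually.of_forall fun x => hL _ _)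
  · rintro θ θc hθ - - φ φ' μ μ' ⟨Φ, h, hb, -⟩ ⟨Φ', h', hb', -⟩
    refine AnisoCH.samePair_of_solvesWeakly (L := θc) hΩ.isOpen hT hmpos hm hA h h' ?_
    filter_upwards [hb, hb'] with t ht ht'
    filter_upwards [ht, ht'] with x hx hx'
    exact AnisoCH.deriv_logPotential_sub_mul_ge hθ hx hx'
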